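/- **Definitions.** An incidence structure consists of points, lines and an incidence relation. An *affine plane* is an incidence structure in which any two distinct points are on exactly one line, for every point $P$ not on a line $l$ there is exactly one line through $P$ having no point in common with $l$, and some three points are not on a common line. Two lines of it are parallel ($\parallel$) if they are equal or have no common point. A finite affine plane has *order* $m$ if each of its lines has exactly $m$ points. In an incidence structure $\mathcal H$, points $P,Q$ are *neighbours* ($P\sim Q$) if $P=Q$ or if they are incident with more than one common line; lines $g,h$ are *neighbours* ($g\sim h$) if every point of $g$ has a neighbour on $h$ and every point of $h$ has a neighbour on $g$. $\mathcal H$ is an *affine Hjelmslev plane* if (1) any two points are on at least one common line; (2) any two lines that meet in more than one point are neighbours; (3) there is an epimorphism $\phi$ (an incidence preserving map, surjective on points and on lines) from $\mathcal H$ onto an affine plane such that $\phi(P)=\phi(Q)\iff P\sim Q$ for all points, $\phi(g)=\phi(h)\iff g\sim h$ for all lines, and $\phi(g)\parallel\phi(h)$ whenever $g$ and $h$ have no common point. For a point $P$, the points of the restriction $\bar P$ are the points $Q\sim P$, and its lines are the nonempty sets $g\cap\bar P$ with $g$ a line of $\mathcal H$. An affine Hjelmslev plane is *2-uniform* if for every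 point $P$ the restriction $\bar P$ is an affine plane and all lines of $\bar P$ are restrictions of the same number of lines of $\mathcal H$. An *orthogonal array* $OA(2,m,m)$ is an $m^2\times m$ array with entries from a set of $m$ symbols such that in any two distinct columns each ordered pair of symbols occurs in exactly one row. **Construction.** Take an affine plane $\mathcal A$ of order $m$; for each point $P$ of $\mathcal A$ an affine plane $\mathcal A_P$ of order $m$; and for each line $l$ of $\mathcal A$ an orthogonal array $\mathcal O_l$ of type $OA(2,m,m)$ (repetitions are allowed). For each line $l$ of $\mathcal A$, label the columns of $\mathcal O_l$ bijectively with the points of $l$, and for each point $P$ of $l$ choose a parallel class of $\mathcal A_P$ and label its lines bijectively with the symbols of $\mathcal O_l$; distinct lines through $P$ must use distinct parallel classes of $\mathcal A_P$. The points of the constructed incidence structure are the pairs $(P,X)$ with $P$ a point of $\mathcal A$ and $X$ a point of $\mathcal A_P$. It has one line for each pair of a line $l$ of $\mathcal A$ and a row of $\mathcal O_l$; the points of this line are the $(P,X)$ with $P$ on $l$ and $X$ on the line of the chosen parallel class of $\mathcal A_P$ whose label is the entry of that row in the column of $P$. **Theorem.** Every finite 2-uniform affine Hjelmslev plane is isomorphic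 to an incidence structure obtained by this construction, for some $m$ and some choice of the planes, arrays, parallel classes and labellings. -/

import Mathlib

universe u v w x

/-- An incidence structure on a type of points and a type of lines. -/
structure IncidenceStructure (Point : Type u) (Line : Type v) where
  /-- `Inc P g`: the point `P` is incident with the line `g`. -/
  Inc : Point → Line → Prop

namespace IncidenceStructure

variable {Point : Type u} {Line : Type v}

/-- Parallelism in an ordinary affine plane: the lines are equal or have no common point. -/
def Parallel (A : IncidenceStructure Point Line) (g h : Line) : Prop :=
  g = h ∨ ∀ P, ¬ (A.Inc P g ∧ A.Inc P h)

/-- Ordinary affine planes. -/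
structure IsAffinePlane (A : IncidenceStructure Point Line) : Prop where
  existsUnique_line : ∀ P Q : Point, P ≠ Q → ∃! g, A.Inc P g ∧ A.Inc Q g
  existsUnique_parallel : ∀ (P : Point) (l : Line), ¬ A.Inc P l →
    ∃! g, A.Inc P g ∧ ∀ Q, ¬ (A.Inc Q g ∧ A.Inc Q l)
  exists_triangle : ∃ P Q R : Point, P ≠ Q ∧ P ≠ R ∧ Q ≠ R ∧
    ¬ ∃ g, A.Inc P g ∧ A.Inc Q g ∧ A.Inc R g

/-- Finite affine planes of order `m`: every line has exactly `m` points. -/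
structure IsAffinePlaneOfOrder (A : IncidenceStructure Point Line) (m : ℕ) : Prop where
  isAffinePlane : A.IsAffinePlane
  finite_point : Finite Point
  card_line : ∀ g, Nat.card {P // A.Inc P g} = m

/-- The classes of the parallelism of an affine plane. -/
def IsParallelClass (A : IncidenceStructure Point Line) (C : Set Line) : Prop :=
  ∃ l, C = {g | A.Parallel g l}

/-- Two points are neighbours if they are equal or are incident with more than one common line. -/
def PointNeighbour (H : IncidenceStructure Point Line) (P Q : Point) : Prop :=
  P = Q ∨ ∃ g h, g ≠ h ∧ (H.Inc P g ∧ H.Inc Q g) ∧ (H.Inc P h ∧ H.Inc Q h)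

/-- Two lines are neighbours if every point of either line has a neighbour on the other line. -/
def LineNeighbour (H : IncidenceStructure Point Line) (g h : Line) : Prop :=
  (∀ P, H.Inc P g → ∃ Q, H.Inc Q h ∧ H.PointNeighbour P Q) ∧
  (∀ Q, H.Inc Q h → ∃ P, H.Inc P g ∧ H.PointNeighbour P Q)

/-- An epimorphism from `H` to `A`: surjective on points and on lines, incidence preserving. -/
structure Epimorphism {Point' : Type w} {Line' : Type x}
    (H : IncidenceStructure Point Line) (A : IncidenceStructure Point' Line') where
  onPoint : Point → Point'
  onLine : Line → Line'
  onPoint_surjective : Function.Surjective onPoint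
  onLine_surjective : Function.Surjective onLine
  map_inc : ∀ P g, H.Inc P g → A.Inc (onPoint P) (onLine g)

/-- An isomorphism of incidence structures. -/
structure Iso {Point' : Type w} {Line' : Type x}
    (H : IncidenceStructure Point Line) (K : IncidenceStructure Point' Line') where
  pointEquiv : Point ≃ Point'
  lineEquiv : Line ≃ Line'
  inc_iff : ∀ P g, K.Inc (pointEquiv P) (lineEquiv g) ↔ H.Inc P g

/-- Affine Hjelmslev planes. -/
structure IsAffineHjelmslevPlane (H : IncidenceStructure Point Line) : Prop where
  exists_line : ∀ P Q : Point, ∃ g, H.Inc P g ∧ H.Inc Q g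
  lineNeighbour_of_meet : ∀ g h : Line,
    (∃ P Q, P ≠ Q ∧ (H.Inc P g ∧ H.Inc P h) ∧ (H.Inc Q g ∧ H.Inc Q h)) → H.LineNeighbour g h
  exists_epimorphism : ∃ (Point' : Type u) (Line' : Type v)
    (A : IncidenceStructure Point' Line') (φ : Epimorphism H A), A.IsAffinePlane ∧
      (∀ P Q, φ.onPoint P = φ.onPoint Q ↔ H.PointNeighbour P Q) ∧
      (∀ g h, φ.onLine g = φ.onLine h ↔ H.LineNeighbour g h) ∧
      (∀ g h, (∀ P, ¬ (H.Inc P g ∧ H.Inc P h)) → A.Parallel (φ.onLine g) (φ.onLine h))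

/-- The points of the point-neighbourhood of `P`. -/
abbrev NbhdPoint (H : IncidenceStructure Point Line) (P : Point) : Type u :=
  {Q : Point // H.PointNeighbour Q P}

/-- The restriction of the line `g` to the point-neighbourhood of `P`. -/
def trace (H : IncidenceStructure Point Line) (P : Point) (g : Line) : Set (H.NbhdPoint P) :=
  {Q | H.Inc Q.1 g}

/-- The lines of the point-neighbourhood restriction: the nonempty restrictions of lines,
as sets of points. -/
abbrev NbhdLine (H : IncidenceStructure Point Line) (P : Point) : Type u :=
  {S : Set (H.NbhdPoint P) // S.Nonempty ∧ ∃ g, S = H.trace P g}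

/-- The point-neighbourhood restriction at `P`. -/
def nbhdRestriction (H : IncidenceStructure Point Line) (P : Point) :
    IncidenceStructure (H.NbhdPoint P) (H.NbhdLine P) where
  Inc Q S := Q ∈ S.1

/-- 2-uniform affine Hjelmslev planes: every point-neighbourhood restriction is an ordinary
affine plane (a 1-uniform affine Hjelmslev plane), and for each point `P` all lines of the
restriction at `P` are restrictions of the same number of lines. -/
structure IsTwoUniformAffineHjelmslevPlane (H : IncidenceStructure Point Line) : Prop where
  isAffineHjelmslevPlane : H.IsAffineHjelmslevPlane
  nbhd_isAffinePlane : ∀ P, (H.nbhdRestriction P).IsAffinePlane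
  nbhd_card : ∀ P, ∃ k : ℕ, ∀ S : H.NbhdLine P, Nat.card {g // H.trace P g = S.1} = k

end IncidenceStructure

/-- An orthogonal array `OA(t, k, n)`: `n ^ t` rows, `k` columns, `n` symbols, and in any `t`
columns each ordered `t`-tuple of symbols occurs in exactly one row. -/
structure OrthogonalArray (t k n : ℕ) where
  entry : Fin (n ^ t) → Fin k → Fin n
  existsUnique_row : ∀ (c : Fin t ↪ Fin k) (s : Fin t → Fin n), ∃! i, ∀ j, entry i (c j) = s j

/-- The objects and the choices which are made in the construction of an affine Hjelmslev plane
from affine planes of order `m` and orthogonal arrays `OA(2, m, m)`. -/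
structure AffineConstruction (m : ℕ) where
  /-- The affine plane of order `m` whose points are to be replaced. -/
  BasePoint : Type u
  BaseLine : Type v
  base : IncidenceStructure BasePoint BaseLine
  base_order : base.IsAffinePlaneOfOrder m
  /-- For each point `P` of the base, an affine plane of order `m`. -/
  FibrePoint : BasePoint → Type w
  FibreLine : BasePoint → Type x
  fibre : ∀ P, IncidenceStructure (FibrePoint P) (FibreLine P)
  fibre_order : ∀ P, (fibre P).IsAffinePlaneOfOrder m
  /-- For each line of the base, an orthogonal array. -/
  array : BaseLine → OrthogonalArray 2 m m
  /-- The columns of the array of `l` are labelled with the points of `l`. -/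
  column : ∀ l, {P // base.Inc P l} ≃ Fin m
  /-- For each line `l` of the base and each point `P` of `l`, a parallel class of the plane at
  `P`; distinct lines through `P` use distinct classes. -/
  parallelClass : ∀ P, {l // base.Inc P l} → Set (FibreLine P)
  isParallelClass : ∀ P l, (fibre P).IsParallelClass (parallelClass P l)
  parallelClass_injective : ∀ P, Function.Injective (parallelClass P)
  /-- The lines of the chosen parallel class are labelled with the symbols. -/
  label : ∀ P l, Fin m ≃ parallelClass P l

/-- The constructed incidence structure. Its points are the pairs of a point `P` of the base and a
point of the affine plane at `P`. It has a line for each line `l` of the base and each row of the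
array of `l`: that line consists of the points which lie, for some point `P` of `l`, on the line of
the plane at `P` labelled with the entry of the row in the column of `P`. -/
def AffineConstruction.result {m : ℕ} (D : AffineConstruction.{u, v, w, x} m) :
    IncidenceStructure (Σ P : D.BasePoint, D.FibrePoint P) (D.BaseLine × Fin (m ^ 2)) where
  Inc X g := ∃ h : D.base.Inc X.1 g.1,
    (D.fibre X.1).Inc X.2
      (D.label X.1 ⟨g.1, h⟩ ((D.array g.1).entry g.2 (D.column g.1 ⟨X.1, h⟩))).1

/-! Let `φ` map `H` onto the affine plane `A`, let `m` be the order of `A`, and write n(X) for the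
order of the neighbourhood plane at X. The base plane is `A`, the fibres are the neighbourhood
planes, and the rows of the array of a line l are the lines of `H` over l. Three things are needed:
n(X) = m for every X; the traces at p of the lines over l form a parallel class; and a line over l
is determined by its traces at two points, which may be prescribed.

All three rest on t(X,l) = `traceCount`, the number of directions in which lines over l pass through
X, being 1. Two counts control it. Summing t(X,l) over the m + 1 lines l through the image of X
gives n(X) + 1 (`sum_traceCount`). For Y over another point of l, the lines over l through X number
n(Y) and also k t(X,l), where k is the uniform multiplicity at X (`nbhdOrder_eq_mul_traceCount`).
Geometry adds that if t(X,l) ≥ 2, then t(Y,l) = 1 (`trace_eq_of_trace_ne`). A point of maximal order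
greater than m would contradict these facts (`nbhdOrder_le`). So n(X) ≤ m, and since every summand
is at least 1, every t(X,l) is 1 and n(X) = m.

Hence lines over l that meet have the same trace at a common point (`inc_iff_inc`), from which the
parallel classes and the arrays follow. -/

namespace IncidenceStructure

/-! ### Counting in finite affine planes -/

namespace IsAffinePlane

variable {Point : Type u} {Line : Type v} {A : IncidenceStructure Point Line}

theorem line_unique (hA : A.IsAffinePlane) {P Q : Point} (hne : P ≠ Q) {g h : Line}
    (hPg : A.Inc P g) (hQg : A.Inc Q g) (hPh : A.Inc P h) (hQh : A.Inc Q h) : g = h :=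
  (hA.existsUnique_line P Q hne).unique ⟨hPg, hQg⟩ ⟨hPh, hQh⟩

theorem point_unique (hA : A.IsAffinePlane) {g h : Line} (hne : g ≠ h) {P Q : Point}
    (hPg : A.Inc P g) (hPh : A.Inc P h) (hQg : A.Inc Q g) (hQh : A.Inc Q h) : P = Q := by
  by_contra hPQ
  exact hne (hA.line_unique hPQ hPg hQg hPh hQh)

theorem exists_not_inc (hA : A.IsAffinePlane) (l : Line) : ∃ P, ¬ A.Inc P l := by
  obtain ⟨P, Q, R, -, -, -, h⟩ := hA.exists_triangle
  by_contra! hl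
  exact h ⟨l, hl P, hl Q, hl R⟩

theorem exists_line_ne (hA : A.IsAffinePlane) (P : Point) (l : Line) :
    ∃ g, A.Inc P g ∧ g ≠ l := by
  by_cases hP : A.Inc P l
  · obtain ⟨R, hR⟩ := hA.exists_not_inc l
    have hne : P ≠ R := fun h => hR (h ▸ hP)
    obtain ⟨g, ⟨hg, hg'⟩, -⟩ := hA.existsUnique_line P R hne
    exact ⟨g, hg, fun h => hR (h ▸ hg')⟩
  · obtain ⟨g, ⟨hg, -⟩, -⟩ := hA.existsUnique_parallel P l hP
    exact ⟨g, hg, fun h => hP (h ▸ hg)⟩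

theorem exists_line_avoiding (hA : A.IsAffinePlane) {P Q : Point} (hne : P ≠ Q) :
    ∃ l, ¬ A.Inc P l ∧ ¬ A.Inc Q l := by
  obtain ⟨d, ⟨hP, hQ⟩, -⟩ := hA.existsUnique_line P Q hne
  obtain ⟨R, hR⟩ := hA.exists_not_inc d
  obtain ⟨l, ⟨-, hl⟩, -⟩ := hA.existsUnique_parallel R d hR
  exact ⟨l, fun h => hl P ⟨h, hP⟩, fun h => hl Q ⟨h, hQ⟩⟩

theorem existsUnique_parallel_through (hA : A.IsAffinePlane) (P : Point) (l : Line) :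
    ∃! g, A.Inc P g ∧ A.Parallel g l := by
  by_cases hP : A.Inc P l
  · refine ⟨l, ⟨hP, Or.inl rfl⟩, ?_⟩
    rintro g ⟨hg, rfl | hgl⟩
    · rfl
    · exact absurd ⟨hg, hP⟩ (hgl P)
  · obtain ⟨g, ⟨hg, hgl⟩, hu⟩ := hA.existsUnique_parallel P l hP
    refine ⟨g, ⟨hg, Or.inr hgl⟩, ?_⟩
    rintro h ⟨hh, rfl | hhl⟩
    · exact absurd hh hP
    · exact hu h ⟨hh, hhl⟩

theorem eq_of_parallel (hA : A.IsAffinePlane) {P : Point} {g h l : Line} (hg : A.Parallel g l)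
    (hh : A.Parallel h l) (hPg : A.Inc P g) (hPh : A.Inc P h) : g = h :=
  (hA.existsUnique_parallel_through P l).unique ⟨hPg, hg⟩ ⟨hPh, hh⟩

theorem parallel_trans (hA : A.IsAffinePlane) {g g' l : Line} (hg : A.Parallel g l) (hg' : A.Parallel l g') :
    A.Parallel g g' := by
  by_cases hP : ∃ P, A.Inc P g ∧ A.Inc P g'
  · obtain ⟨P, hP, hP'⟩ := hP
    refine Or.inl (hA.eq_of_parallel hg ?_ hP hP')
    rcases hg' with rfl | hg'
    · exact Or.inl rfl
    · exact Or.inr fun Q hQ => hg' Q hQ.symm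
  · exact Or.inr (not_exists.1 hP)

/-- A line through `P` either meets `l` in exactly one point or is the unique parallel to `l`; the
parallel corresponds to `none`. -/
theorem card_lines_through_of_not_inc [Finite Point] (hA : A.IsAffinePlane) {P : Point} {l : Line}
    (hP : ¬ A.Inc P l) :
    Nat.card {g // A.Inc P g} = Nat.card {Q // A.Inc Q l} + 1 := by
  have hne : ∀ Q : {Q // A.Inc Q l}, P ≠ Q.1 := fun Q h => hP (h ▸ Q.2)
  choose f hf using fun Q : {Q // A.Inc Q l} => (hA.existsUnique_line P Q.1 (hne Q)).exists
  obtain ⟨p, ⟨hp, hpl⟩, hpu⟩ := hA.existsUnique_parallel P l hP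
  rw [← Finite.card_option]
  symm
  refine Nat.card_eq_of_bijective
    (fun o : Option {Q // A.Inc Q l} => (o.elim ⟨p, hp⟩ fun Q => ⟨f Q, (hf Q).1⟩ :
      {g // A.Inc P g})) ⟨?_, ?_⟩
  · rintro (_ | Q) (_ | R) h
    · rfl
    · simp only [Option.elim, Subtype.mk.injEq] at h
      exact absurd ⟨h ▸ (hf R).2, R.2⟩ (hpl R.1)
    · simp only [Option.elim, Subtype.mk.injEq] at h
      exact absurd ⟨h ▸ (hf Q).2, Q.2⟩ (hpl Q.1)
    · simp only [Option.elim, Subtype.mk.injEq] at h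
      congr 1
      have hfl : f Q ≠ l := fun h' => hP (h' ▸ (hf Q).1)
      exact Subtype.ext (hA.point_unique hfl (hf Q).2 Q.2 (h ▸ (hf R).2) R.2)
  · rintro ⟨g, hg⟩
    by_cases hgl : ∃ Q, A.Inc Q g ∧ A.Inc Q l
    · obtain ⟨Q, hQg, hQl⟩ := hgl
      exact ⟨some ⟨Q, hQl⟩, Subtype.ext
        (hA.line_unique (hne ⟨Q, hQl⟩) (hf ⟨Q, hQl⟩).1 (hf ⟨Q, hQl⟩).2 hg hQg)⟩
    · exact ⟨none, Subtype.ext (hpu g ⟨hg, not_exists.1 hgl⟩).symm⟩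

/-- The line `d` is a transversal: every line of the parallel class of `l` meets it exactly once. -/
theorem card_parallel (hA : A.IsAffinePlane) {Q : Point} {d l : Line} (hQd : A.Inc Q d)
    (hQl : A.Inc Q l) (hne : d ≠ l) :
    Nat.card {g // A.Parallel g l} = Nat.card {P // A.Inc P d} := by
  choose f hf using fun P => (hA.existsUnique_parallel_through P l).exists
  symm
  refine Nat.card_eq_of_bijective
    (fun P : {P // A.Inc P d} => (⟨f P.1, (hf P.1).2⟩ : {g // A.Parallel g l})) ⟨?_, ?_⟩
  · rintro ⟨P, hP⟩ ⟨R, hR⟩ h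
    simp only [Subtype.mk.injEq] at h ⊢
    have hfd : f P ≠ d := by
      intro h'
      have := (hf P).2
      rw [h'] at this
      exact hne (hA.eq_of_parallel this (Or.inl rfl) hQd hQl)
    exact hA.point_unique hfd (hf P).1 hP (h ▸ (hf R).1) hR
  · rintro ⟨g, hg⟩
    have : ∃ P, A.Inc P d ∧ A.Inc P g := by
      by_contra hdg
      refine hne (hA.eq_of_parallel (P := Q) (l := g) (Or.inr (not_exists.1 hdg)) ?_ hQd hQl)
      rcases hg with rfl | hg
      · exact Or.inl rfl
      · exact Or.inr fun P hP => hg P hP.symm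
    obtain ⟨P, hPd, hPg⟩ := this
    exact ⟨⟨P, hPd⟩, Subtype.ext (hA.eq_of_parallel (hf P).2 hg (hf P).1 hPg)⟩

theorem exists_order [Finite Point] [Finite Line] (hA : A.IsAffinePlane) :
    ∃ n, 2 ≤ n ∧ (∀ P, Nat.card {g // A.Inc P g} = n + 1) ∧
      (∀ l, Nat.card {P // A.Inc P l} = n) ∧ Nat.card Point = n * n := by
  have hr : ∀ P Q, Nat.card {g // A.Inc P g} = Nat.card {g // A.Inc Q g} := by
    intro P Q
    rcases eq_or_ne P Q with rfl | hne
    · rfl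
    · obtain ⟨l, hP, hQ⟩ := hA.exists_line_avoiding hne
      rw [hA.card_lines_through_of_not_inc hP, hA.card_lines_through_of_not_inc hQ]
  have hl : ∀ l l', Nat.card {P // A.Inc P l} = Nat.card {P // A.Inc P l'} := by
    intro l l'
    obtain ⟨P, hP⟩ := hA.exists_not_inc l
    obtain ⟨P', hP'⟩ := hA.exists_not_inc l'
    have := hr P P'
    rw [hA.card_lines_through_of_not_inc hP, hA.card_lines_through_of_not_inc hP'] at this
    omega
  obtain ⟨P, Q, R, hPQ, -, -, hPQR⟩ := hA.exists_triangle
  obtain ⟨l, ⟨hPl, hQl⟩, -⟩ := hA.existsUnique_line P Q hPQ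
  have hRl : ¬ A.Inc R l := fun h => hPQR ⟨l, hPl, hQl, h⟩
  refine ⟨Nat.card {P // A.Inc P l}, ?_, fun X => ?_, fun l' => hl l' l, ?_⟩
  · have : Nontrivial {P // A.Inc P l} :=
      ⟨⟨P, hPl⟩, ⟨Q, hQl⟩, fun h => hPQ (congrArg Subtype.val h)⟩
    exact Finite.one_lt_card
  · rw [hr X R, hA.card_lines_through_of_not_inc hRl]
  · obtain ⟨d, hPd, hdl⟩ := hA.exists_line_ne P l
    have : Fintype {g // A.Parallel g l} := Fintype.ofFinite _
    choose f hf using fun P => (hA.existsUnique_parallel_through P l).exists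
    -- The parallel class of `l` partitions the points.
    have e : Nat.card Point = Nat.card (Σ g : {g // A.Parallel g l}, {P // A.Inc P g.1}) := by
      refine Nat.card_eq_of_bijective (fun P => ⟨⟨f P, (hf P).2⟩, ⟨P, (hf P).1⟩⟩) ⟨?_, ?_⟩
      · intro P Q h
        exact congrArg (fun z => z.2.1) h
      · rintro ⟨⟨g, hg⟩, ⟨P, hP⟩⟩
        obtain rfl : f P = g := hA.eq_of_parallel (hf P).2 hg (hf P).1 hP
        exact ⟨P, rfl⟩
    rw [e, Nat.card_sigma, Finset.sum_congr rfl fun g _ => hl g.1 l, Finset.sum_const,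
      Finset.card_univ, smul_eq_mul, ← Nat.card_eq_fintype_card, hA.card_parallel hPd hPl hdl,
      hl d l]

theorem exists_point_ne [Finite Point] [Finite Line] (hA : A.IsAffinePlane) (P : Point)
    (l : Line) : ∃ Q, Q ≠ P ∧ A.Inc Q l := by
  obtain ⟨n, hn, -, hl, -⟩ := hA.exists_order
  have h1 : 1 < Nat.card {Q // A.Inc Q l} := by rw [hl]; omega
  have : Nontrivial {Q // A.Inc Q l} := Finite.one_lt_card_iff_nontrivial.1 h1
  by_contra! h
  obtain ⟨Q, R, hne⟩ := this
  exact hne (Subtype.ext ((not_imp_not.1 (h Q.1) Q.2).trans (not_imp_not.1 (h R.1) R.2).symm))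

end IsAffinePlane

/-! ### Neighbourhood planes and lifting of incidences along the epimorphism -/

variable {Point : Type u} {Line : Type v} {Point' : Type w} {Line' : Type x}

/-- The epimorphism `φ` onto the affine plane `A` witnesses that the 2-uniform structure `H` is an
affine Hjelmslev plane. -/
structure Epimorphism.IsNeighbourMap {H : IncidenceStructure Point Line}
    {A : IncidenceStructure Point' Line'} (φ : Epimorphism H A) : Prop where
  twoUniform : H.IsTwoUniformAffineHjelmslevPlane
  isAffinePlane : A.IsAffinePlane
  onPoint_eq_iff : ∀ P Q, φ.onPoint P = φ.onPoint Q ↔ H.PointNeighbour P Q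
  onLine_eq_iff : ∀ g h, φ.onLine g = φ.onLine h ↔ H.LineNeighbour g h
  parallel : ∀ g h, (∀ P, ¬ (H.Inc P g ∧ H.Inc P h)) → A.Parallel (φ.onLine g) (φ.onLine h)

/-- The order of the neighbourhood restriction at `X`. -/
noncomputable def nbhdOrder (H : IncidenceStructure Point Line) (X : Point) : ℕ :=
  Nat.sqrt (Nat.card (H.NbhdPoint X))

/-- The line of the neighbourhood restriction at `X` cut out by `g`. -/
def traceLine (H : IncidenceStructure Point Line) (X : Point) (g : Line)
    (hg : ∃ Z, H.PointNeighbour Z X ∧ H.Inc Z g) : H.NbhdLine X :=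
  ⟨H.trace X g, ⟨⟨hg.choose, hg.choose_spec.1⟩, hg.choose_spec.2⟩, g, rfl⟩

/-- The number of traces at `X`, through `X`, of lines which `φ` maps to `l`. -/
noncomputable def Epimorphism.traceCount {H : IncidenceStructure Point Line}
    {A : IncidenceStructure Point' Line'} (φ : Epimorphism H A) (X : Point) (l : Line') : ℕ :=
  Nat.card {S : H.NbhdLine X // ∃ g, φ.onLine g = l ∧ H.Inc X g ∧ S.1 = H.trace X g}

namespace Epimorphism.IsNeighbourMap

variable {H : IncidenceStructure Point Line} {A : IncidenceStructure Point' Line'}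
  {φ : Epimorphism H A}

theorem nbhdOrder_spec [Finite Point] (h : φ.IsNeighbourMap) (X : Point) :
    2 ≤ H.nbhdOrder X ∧
      (∀ Z, Nat.card {S // (H.nbhdRestriction X).Inc Z S} = H.nbhdOrder X + 1) ∧
      (∀ S, Nat.card {Z // (H.nbhdRestriction X).Inc Z S} = H.nbhdOrder X) ∧
      Nat.card (H.NbhdPoint X) = H.nbhdOrder X * H.nbhdOrder X := by
  obtain ⟨n, hn⟩ := (h.twoUniform.nbhd_isAffinePlane X).exists_order
  have : H.nbhdOrder X = n := by rw [nbhdOrder, hn.2.2.2, Nat.sqrt_eq]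
  rwa [this]

theorem neighbour_refl (X : Point) : H.PointNeighbour X X := Or.inl rfl

theorem line_unique (h : φ.IsNeighbourMap) {X Y : Point} (hXY : φ.onPoint X ≠ φ.onPoint Y)
    {g g' : Line} (hXg : H.Inc X g) (hYg : H.Inc Y g) (hXg' : H.Inc X g') (hYg' : H.Inc Y g') :
    g = g' := by
  by_contra hne
  exact hXY ((h.onPoint_eq_iff X Y).2 (Or.inr ⟨g, g', hne, ⟨hXg, hYg⟩, hXg', hYg'⟩))

theorem onLine_eq_of_ne (h : φ.IsNeighbourMap) {X Y : Point} (hXY : X ≠ Y)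
    {g g' : Line} (hXg : H.Inc X g) (hYg : H.Inc Y g) (hXg' : H.Inc X g') (hYg' : H.Inc Y g') :
    φ.onLine g = φ.onLine g' :=
  (h.onLine_eq_iff g g').2
    (h.twoUniform.isAffineHjelmslevPlane.lineNeighbour_of_meet g g'
      ⟨X, Y, hXY, ⟨hXg, hXg'⟩, hYg, hYg'⟩)

/-- Disjoint lines have parallel images, so two lines whose distinct images meet must themselves
meet, and can do so only over the common point `p`. -/
theorem exists_meet (h : φ.IsNeighbourMap) {g g' : Line} (hne : φ.onLine g ≠ φ.onLine g')
    {p : Point'} (hp : A.Inc p (φ.onLine g)) (hp' : A.Inc p (φ.onLine g')) :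
    ∃ X, φ.onPoint X = p ∧ H.Inc X g ∧ H.Inc X g' := by
  have : ∃ X, H.Inc X g ∧ H.Inc X g' := by
    by_contra hX
    rcases h.parallel g g' (not_exists.1 hX) with he | hd
    · exact hne he
    · exact hd p ⟨hp, hp'⟩
  obtain ⟨X, hX, hX'⟩ := this
  exact ⟨X, h.isAffinePlane.point_unique hne (φ.map_inc _ _ hX) (φ.map_inc _ _ hX') hp hp', hX, hX'⟩

theorem exists_inc (h : φ.IsNeighbourMap) {g : Line} {p : Point'} (hp : A.Inc p (φ.onLine g)) :
    ∃ X, φ.onPoint X = p ∧ H.Inc X g := by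
  obtain ⟨l, hpl, hne⟩ := h.isAffinePlane.exists_line_ne p (φ.onLine g)
  obtain ⟨g', rfl⟩ := φ.onLine_surjective l
  obtain ⟨X, hX, hXg, -⟩ := h.exists_meet hne.symm hp hpl
  exact ⟨X, hX, hXg⟩

theorem exists_neighbour_inc (h : φ.IsNeighbourMap) {g : Line} {X : Point}
    (hX : A.Inc (φ.onPoint X) (φ.onLine g)) : ∃ Z, H.PointNeighbour Z X ∧ H.Inc Z g := by
  obtain ⟨Z, hZ, hZg⟩ := h.exists_inc hX
  exact ⟨Z, (h.onPoint_eq_iff Z X).1 hZ, hZg⟩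

theorem exists_join (h : φ.IsNeighbourMap) {X Y : Point} (hXY : φ.onPoint X ≠ φ.onPoint Y)
    {l : Line'} (hX : A.Inc (φ.onPoint X) l) (hY : A.Inc (φ.onPoint Y) l) :
    ∃ g, φ.onLine g = l ∧ H.Inc X g ∧ H.Inc Y g := by
  obtain ⟨g, hXg, hYg⟩ := h.twoUniform.isAffineHjelmslevPlane.exists_line X Y
  exact ⟨g, h.isAffinePlane.line_unique hXY (φ.map_inc _ _ hXg) (φ.map_inc _ _ hYg) hX hY,
    hXg, hYg⟩

theorem exists_ne_of_nbhdLine [Finite Point] (h : φ.IsNeighbourMap) {X : Point}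
    (S : H.NbhdLine X) : ∃ Z ∈ S.1, ∃ W ∈ S.1, Z.1 ≠ W.1 := by
  have h1 := (h.nbhdOrder_spec X).1
  rw [← (h.nbhdOrder_spec X).2.2.1 S] at h1
  obtain ⟨Z, W, hne⟩ := Finite.one_lt_card_iff_nontrivial.1 h1
  exact ⟨Z.1, Z.2, W.1, W.2, fun hh => hne (Subtype.ext (Subtype.ext hh))⟩

/-- A trace has at least two points, and lines sharing two points are neighbours. So each trace
belongs to a single line of `A`. -/
theorem onLine_eq_of_trace [Finite Point] (h : φ.IsNeighbourMap) {X : Point} (S : H.NbhdLine X)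
    {g g' : Line} (hg : S.1 = H.trace X g) (hg' : S.1 = H.trace X g') :
    φ.onLine g = φ.onLine g' := by
  obtain ⟨Z, hZ, W, hW, hne⟩ := h.exists_ne_of_nbhdLine S
  have hZ' := hZ
  have hW' := hW
  rw [hg] at hZ hW
  rw [hg'] at hZ' hW'
  exact h.onLine_eq_of_ne hne hZ hW hZ' hW'

theorem exists_point_over_ne [Finite Point] [Finite Line] (h : φ.IsNeighbourMap) (X : Point)
    (l : Line') : ∃ Y, φ.onPoint X ≠ φ.onPoint Y ∧ A.Inc (φ.onPoint Y) l := by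
  have : Finite Point' := Finite.of_surjective _ φ.onPoint_surjective
  have : Finite Line' := Finite.of_surjective _ φ.onLine_surjective
  obtain ⟨q, hq, hql⟩ := h.isAffinePlane.exists_point_ne (φ.onPoint X) l
  obtain ⟨Y, rfl⟩ := φ.onPoint_surjective q
  exact ⟨Y, hq.symm, hql⟩

/-! ### The two counts of traces -/

theorem one_le_traceCount [Finite Point] [Finite Line] (h : φ.IsNeighbourMap) {X : Point}
    {l : Line'} (hX : A.Inc (φ.onPoint X) l) : 1 ≤ φ.traceCount X l := by
  obtain ⟨Y, hXY, hY⟩ := h.exists_point_over_ne X l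
  obtain ⟨g, hg, hXg, -⟩ := h.exists_join hXY hX hY
  have : Nonempty {S : H.NbhdLine X // ∃ g, φ.onLine g = l ∧ H.Inc X g ∧ S.1 = H.trace X g} :=
    ⟨⟨H.traceLine X g ⟨X, neighbour_refl X, hXg⟩, g, hg, hXg, rfl⟩⟩
  exact Nat.card_pos

theorem exists_of_two_le_traceCount [Finite Point] {X : Point} {l : Line'}
    (hc : 2 ≤ φ.traceCount X l) : ∃ g g', φ.onLine g = l ∧ φ.onLine g' = l ∧ H.Inc X g ∧
      H.Inc X g' ∧ H.trace X g ≠ H.trace X g' := by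
  obtain ⟨⟨S, g, hg, hXg, hS⟩, ⟨S', g', hg', hXg', hS'⟩, hne⟩ :=
    Finite.one_lt_card_iff_nontrivial.1 hc
  refine ⟨g, g', hg, hg', hXg, hXg', fun hh => hne ?_⟩
  exact Subtype.ext (Subtype.ext (hS.trans (hh.trans hS'.symm)))

theorem traceCount_le_one [Finite Point] {X : Point} {l : Line'}
    (hc : ∀ g g', φ.onLine g = l → φ.onLine g' = l → H.Inc X g → H.Inc X g' →
      H.trace X g = H.trace X g') : φ.traceCount X l ≤ 1 := by
  refine Finite.card_le_one_iff_subsingleton.2 ⟨?_⟩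
  rintro ⟨S, g, hg, hXg, hS⟩ ⟨S', g', hg', hXg', hS'⟩
  exact Subtype.ext (Subtype.ext (hS.trans ((hc g g' hg hg' hXg hXg').trans hS'.symm)))

/-- With n the order at `Y`, each of the n² neighbours of `Y` is joined to `X` by exactly one line,
and each of these lines contains n of the neighbours. -/
theorem card_lines_through [Finite Point] [Finite Line] (h : φ.IsNeighbourMap) {X Y : Point}
    (hXY : φ.onPoint X ≠ φ.onPoint Y) {l : Line'} (hX : A.Inc (φ.onPoint X) l)
    (hY : A.Inc (φ.onPoint Y) l) :
    Nat.card {g // φ.onLine g = l ∧ H.Inc X g} = H.nbhdOrder Y := by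
  obtain ⟨hn, -, hl, hv⟩ := h.nbhdOrder_spec Y
  have hne : ∀ Z : H.NbhdPoint Y, φ.onPoint X ≠ φ.onPoint Z.1 := fun Z => by
    rwa [(h.onPoint_eq_iff Z.1 Y).2 Z.2]
  choose f hf using fun Z : H.NbhdPoint Y => h.exists_join (hne Z) hX
    (by rwa [(h.onPoint_eq_iff Z.1 Y).2 Z.2])
  have : Fintype {g // φ.onLine g = l ∧ H.Inc X g} := Fintype.ofFinite _
  have e : Nat.card (H.NbhdPoint Y) =
      Nat.card (Σ g : {g // φ.onLine g = l ∧ H.Inc X g}, {Z : H.NbhdPoint Y // H.Inc Z.1 g.1}) := by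
    refine Nat.card_eq_of_bijective
      (fun Z => ⟨⟨f Z, (hf Z).1, (hf Z).2.1⟩, ⟨Z, (hf Z).2.2⟩⟩) ⟨?_, ?_⟩
    · intro Z W hh
      exact congrArg (fun z => z.2.1) hh
    · rintro ⟨⟨g, hg, hXg⟩, Z, hZ⟩
      obtain rfl : f Z = g := h.line_unique (hne Z) (hf Z).2.1 (hf Z).2.2 hXg hZ
      exact ⟨Z, rfl⟩
  have e2 : ∀ g : {g // φ.onLine g = l ∧ H.Inc X g},
      Nat.card {Z : H.NbhdPoint Y // H.Inc Z.1 g.1} = H.nbhdOrder Y := fun g =>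
    hl (H.traceLine Y g.1 (h.exists_neighbour_inc (by rw [g.2.1]; exact hY)))
  rw [hv, Nat.card_sigma, Finset.sum_congr rfl fun g _ => e2 g, Finset.sum_const, Finset.card_univ,
    smul_eq_mul, ← Nat.card_eq_fintype_card] at e
  exact (Nat.eq_of_mul_eq_mul_right (by omega) e).symm

/-- The lines over `l` through `X` are grouped by their trace at `X`. All `k` lines with a given
such trace lie over `l`, so each group has size `k`. -/
theorem nbhdOrder_eq_mul_traceCount [Finite Point] [Finite Line] (h : φ.IsNeighbourMap)
    {X Y : Point} (hXY : φ.onPoint X ≠ φ.onPoint Y) {l : Line'} (hX : A.Inc (φ.onPoint X) l)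
    (hY : A.Inc (φ.onPoint Y) l) {k : ℕ}
    (hk : ∀ S : H.NbhdLine X, Nat.card {g // H.trace X g = S.1} = k) :
    H.nbhdOrder Y = k * φ.traceCount X l := by
  rw [← h.card_lines_through hXY hX hY]
  set T := {S : H.NbhdLine X // ∃ g, φ.onLine g = l ∧ H.Inc X g ∧ S.1 = H.trace X g}
  have : Fintype T := Fintype.ofFinite _
  have e : Nat.card {g // φ.onLine g = l ∧ H.Inc X g} =
      Nat.card (Σ S : T, {g // H.trace X g = S.1.1}) := by
    refine Nat.card_eq_of_bijective (fun g => ⟨⟨H.traceLine X g.1 ⟨X, neighbour_refl X, g.2.2⟩,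
      g.1, g.2.1, g.2.2, rfl⟩, ⟨g.1, rfl⟩⟩) ⟨?_, ?_⟩
    · intro g g' hh
      exact Subtype.ext (congrArg (fun z => z.2.1) hh)
    · rintro ⟨⟨⟨S, hS⟩, g, hg, hXg, hSg⟩, g', hg'⟩
      dsimp only at hSg hg'
      subst hg'
      have hX' : H.Inc X g' := by
        have : (⟨X, neighbour_refl X⟩ : H.NbhdPoint X) ∈ H.trace X g := hXg
        rwa [← hSg] at this
      exact ⟨⟨g', (h.onLine_eq_of_trace ⟨_, hS⟩ rfl hSg).trans hg, hX'⟩, rfl⟩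
  rw [e, Nat.card_sigma, Finset.sum_congr rfl fun S _ => hk S.1, Finset.sum_const, Finset.card_univ,
    smul_eq_mul, ← Nat.card_eq_fintype_card, mul_comm]
  rfl

theorem sum_traceCount [Finite Point] (h : φ.IsNeighbourMap)
    (X : Point) [Fintype {l // A.Inc (φ.onPoint X) l}] :
    ∑ l : {l // A.Inc (φ.onPoint X) l}, φ.traceCount X l.1 = H.nbhdOrder X + 1 := by
  rw [← (h.nbhdOrder_spec X).2.1 ⟨X, neighbour_refl X⟩]
  unfold traceCount
  rw [← Nat.card_sigma]
  refine Nat.card_eq_of_bijective (fun S => ⟨S.2.1, ?_⟩) ⟨?_, ?_⟩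
  · obtain ⟨g, -, hXg, hS⟩ := S.2.2
    change _ ∈ S.2.1.1
    rw [hS]
    exact hXg
  · rintro ⟨⟨l, hl⟩, S, g, hg, hXg, hS⟩ ⟨⟨l', hl'⟩, S', g', hg', hXg', hS'⟩ hh
    obtain rfl : S = S' := congrArg Subtype.val hh
    obtain rfl : l = l' := hg.symm.trans ((h.onLine_eq_of_trace S hS hS').trans hg')
    rfl
  · rintro ⟨⟨S, hSn, g, hg⟩, hX⟩
    have hXg : H.Inc X g := by
      change _ ∈ S at hX
      rw [hg] at hX
      exact hX
    exact ⟨⟨⟨φ.onLine g, φ.map_inc _ _ hXg⟩, ⟨S, hSn, g, hg⟩, g, rfl, hXg, hg⟩, rfl⟩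

/-! ### Directions of the lines over a fixed line -/

/-- A line of the neighbourhood at `X` which is parallel to a trace of a line over `l` is only the
trace of lines over `l`. -/
theorem onLine_eq_of_parallel (h : φ.IsNeighbourMap) {X : Point} {g g' : Line}
    (hX : A.Inc (φ.onPoint X) (φ.onLine g)) (hX' : A.Inc (φ.onPoint X) (φ.onLine g'))
    (hd : ∀ Z, H.PointNeighbour Z X → ¬ (H.Inc Z g ∧ H.Inc Z g')) :
    φ.onLine g = φ.onLine g' := by
  by_contra hne
  obtain ⟨Z, hZ, hZg, hZg'⟩ := h.exists_meet hne hX hX'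
  exact hd Z ((h.onPoint_eq_iff _ _).1 hZ) ⟨hZg, hZg'⟩

/-- Two lines over the same line with a common point outside the neighbourhood of `Y` have parallel
traces at `Y`. -/
theorem parallel_trace (h : φ.IsNeighbourMap) {X Y : Point} (hXY : φ.onPoint X ≠ φ.onPoint Y)
    {g g' : Line} (hg : ∃ Z, H.PointNeighbour Z Y ∧ H.Inc Z g)
    (hg' : ∃ Z, H.PointNeighbour Z Y ∧ H.Inc Z g') (hXg : H.Inc X g) (hXg' : H.Inc X g') :
    (H.nbhdRestriction Y).Parallel (H.traceLine Y g hg) (H.traceLine Y g' hg') := by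
  rcases eq_or_ne g g' with rfl | hne
  · exact Or.inl rfl
  · refine Or.inr fun Z hZ => hne (h.line_unique (Y := Z.1) ?_ hXg hZ.1 hXg' hZ.2)
    rwa [(h.onPoint_eq_iff _ _).2 Z.2]

/-- Near `X`, any two points can be linked by lines over `l` in the directions of `g₁` and `g₂`.
Consecutive lines of the chain `h₁`, `a`, `b`, `h₂` meet near `X`, so their traces at `Y` are
parallel; the traces of `h₁` and `h₂` both contain `Y`, so they coincide. -/
theorem trace_eq_of_trace_ne [Finite Point] (h : φ.IsNeighbourMap) {X Y : Point}
    (hXY : φ.onPoint X ≠ φ.onPoint Y) {l : Line'} (hX : A.Inc (φ.onPoint X) l)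
    (hY : A.Inc (φ.onPoint Y) l) {g₁ g₂ : Line} (hg₁ : φ.onLine g₁ = l) (hg₂ : φ.onLine g₂ = l)
    (hXg₁ : H.Inc X g₁) (hXg₂ : H.Inc X g₂) (hne : H.trace X g₁ ≠ H.trace X g₂)
    {h₁ h₂ : Line} (hh₁ : φ.onLine h₁ = l) (hh₂ : φ.onLine h₂ = l)
    (hYh₁ : H.Inc Y h₁) (hYh₂ : H.Inc Y h₂) : H.trace Y h₁ = H.trace Y h₂ := by
  have hF := h.twoUniform.nbhd_isAffinePlane X
  have hG := h.twoUniform.nbhd_isAffinePlane Y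
  have hXn : ∀ g, φ.onLine g = l → ∃ Z, H.PointNeighbour Z X ∧ H.Inc Z g := fun g hg =>
    h.exists_neighbour_inc (by rwa [hg])
  have hYn : ∀ g, φ.onLine g = l → ∃ Z, H.PointNeighbour Z Y ∧ H.Inc Z g := fun g hg =>
    h.exists_neighbour_inc (by rwa [hg])
  obtain ⟨X₁, hX₁, hX₁h⟩ := hXn h₁ hh₁
  obtain ⟨X₂, hX₂, hX₂h⟩ := hXn h₂ hh₂
  -- lines over `l` through a given point in a given direction
  have key : ∀ (Z : H.NbhdPoint X) (g : Line) (hg : φ.onLine g = l),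
      ∃ g', ∃ hg' : φ.onLine g' = l, H.Inc Z.1 g' ∧
        (H.nbhdRestriction X).Parallel (H.traceLine X g' (hXn g' hg'))
          (H.traceLine X g (hXn g hg)) := by
    intro Z g hg
    obtain ⟨⟨S, hS, g', hg'⟩, hZS, hSp⟩ :=
      (hF.existsUnique_parallel_through Z (H.traceLine X g (hXn g hg))).exists
    subst hg'
    have hl : φ.onLine g' = l := by
      have hg'' := φ.map_inc _ _ (show H.Inc Z.1 g' from hZS)
      rw [(h.onPoint_eq_iff _ _).2 Z.2] at hg''
      rcases hSp with he | hd
      · exact (h.onLine_eq_of_trace (H.traceLine X g (hXn g hg))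
          (congrArg Subtype.val he).symm rfl).trans hg
      · refine (h.onLine_eq_of_parallel hg'' (by rwa [hg]) fun W hW hW' => ?_).trans hg
        exact hd ⟨W, hW⟩ hW'
    exact ⟨g', hl, hZS, hSp⟩
  obtain ⟨a, ha, hX₁a, hap⟩ := key ⟨X₁, hX₁⟩ g₁ hg₁
  obtain ⟨b, hb, hX₂b, hbp⟩ := key ⟨X₂, hX₂⟩ g₂ hg₂
  -- Otherwise the traces of `g₁` and `g₂` would be parallel, and equal because both contain `X`.
  have hmeet : ∃ X₃, H.PointNeighbour X₃ X ∧ H.Inc X₃ a ∧ H.Inc X₃ b := by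
    by_contra hd
    have hab : (H.nbhdRestriction X).Parallel (H.traceLine X a (hXn a ha))
        (H.traceLine X b (hXn b hb)) := Or.inr fun Z hZ => hd ⟨Z.1, Z.2, hZ⟩
    have hag₂ := hF.parallel_trans hab hbp
    have hpa : ∀ {g g' : H.NbhdLine X}, (H.nbhdRestriction X).Parallel g g' →
        (H.nbhdRestriction X).Parallel g' g := by
      rintro g g' (rfl | hd)
      · exact Or.inl rfl
      · exact Or.inr fun P hP => hd P hP.symm
    exact hne (congrArg Subtype.val (hF.eq_of_parallel (P := ⟨X, neighbour_refl X⟩) (hpa hap)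
      (hpa hag₂) hXg₁ hXg₂))
  obtain ⟨X₃, hX₃, hX₃a, hX₃b⟩ := hmeet
  have hoff : ∀ Z, H.PointNeighbour Z X → φ.onPoint Z ≠ φ.onPoint Y := fun Z hZ => by
    rwa [(h.onPoint_eq_iff _ _).2 hZ]
  have p₁ := h.parallel_trace (hoff X₁ hX₁) (hYn h₁ hh₁) (hYn a ha) hX₁h hX₁a
  have p₂ := h.parallel_trace (hoff X₃ hX₃) (hYn a ha) (hYn b hb) hX₃a hX₃b
  have p₃ := h.parallel_trace (hoff X₂ hX₂) (hYn b hb) (hYn h₂ hh₂) hX₂b hX₂h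
  exact congrArg Subtype.val (hG.eq_of_parallel (P := ⟨Y, neighbour_refl Y⟩)
    (hG.parallel_trans (hG.parallel_trans p₁ p₂) p₃) (Or.inl rfl) hYh₁ hYh₂)

theorem traceCount_eq_one_of_two_le [Finite Point] [Finite Line] (h : φ.IsNeighbourMap)
    {X Y : Point} (hXY : φ.onPoint X ≠ φ.onPoint Y) {l : Line'} (hX : A.Inc (φ.onPoint X) l)
    (hY : A.Inc (φ.onPoint Y) l) (hc : 2 ≤ φ.traceCount X l) : φ.traceCount Y l = 1 := by
  obtain ⟨g, g', hg, hg', hXg, hXg', hne⟩ := exists_of_two_le_traceCount hc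
  refine le_antisymm (traceCount_le_one fun h₁ h₂ hh₁ hh₂ hYh₁ hYh₂ => ?_) (h.one_le_traceCount hY)
  exact h.trace_eq_of_trace_ne hXY hX hY hg hg' hXg hXg' hne hh₁ hh₂ hYh₁ hYh₂

/-! ### All neighbourhood planes have the order of the base -/

theorem nbhdOrder_eq_of_traceCount_eq_one [Finite Point] [Finite Line] (h : φ.IsNeighbourMap)
    {m : ℕ} (hm : ∀ p, Nat.card {l // A.Inc p l} = m + 1) {X : Point}
    (hc : ∀ l, A.Inc (φ.onPoint X) l → φ.traceCount X l = 1) : H.nbhdOrder X = m := by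
  have : Finite Line' := Finite.of_surjective _ φ.onLine_surjective
  have : Fintype {l // A.Inc (φ.onPoint X) l} := Fintype.ofFinite _
  have hs := h.sum_traceCount X
  rw [Finset.sum_congr rfl fun l _ => hc l.1 l.2, Finset.sum_const, Finset.card_univ, smul_eq_mul,
    ← Nat.card_eq_fintype_card, hm] at hs
  omega

theorem traceCount_eq_one_of_nbhdOrder_le [Finite Point] [Finite Line] (h : φ.IsNeighbourMap)
    {m : ℕ} (hm : ∀ p, Nat.card {l // A.Inc p l} = m + 1) {X : Point} (hX : H.nbhdOrder X ≤ m)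
    {l : Line'} (hl : A.Inc (φ.onPoint X) l) : φ.traceCount X l = 1 := by
  have : Finite Line' := Finite.of_surjective _ φ.onLine_surjective
  have : Fintype {l // A.Inc (φ.onPoint X) l} := Fintype.ofFinite _
  have hs := h.sum_traceCount X
  have h1 : ∑ l : {l // A.Inc (φ.onPoint X) l}, 1 = m + 1 := by
    rw [Finset.sum_const, Finset.card_univ, smul_eq_mul, ← Nat.card_eq_fintype_card, hm, mul_one]
  refine le_antisymm ?_ (h.one_le_traceCount hl)
  by_contra! hlt
  have := Finset.sum_lt_sum (f := fun _ => 1)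
    (g := fun l : {l // A.Inc (φ.onPoint X) l} => φ.traceCount X l.1) (s := Finset.univ)
    (fun l _ => h.one_le_traceCount l.2) ⟨⟨l, hl⟩, Finset.mem_univ _, hlt⟩
  omega

/-- Since `Q` has only one direction over `l`, its multiplicity `k` equals the maximal order. Every
order elsewhere is `k` times a trace count at `Q`, so maximality forces these counts to be 1. -/
theorem nbhdOrder_of_maximal [Finite Point] [Finite Line] (h : φ.IsNeighbourMap)
    {m : ℕ} (hm : ∀ p, Nat.card {l // A.Inc p l} = m + 1) {P : Point}
    (hP : ∀ X, H.nbhdOrder X ≤ H.nbhdOrder P) {l : Line'} (hPl : A.Inc (φ.onPoint P) l)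
    (hc : 2 ≤ φ.traceCount P l) {Q : Point} (hPQ : φ.onPoint P ≠ φ.onPoint Q)
    (hQl : A.Inc (φ.onPoint Q) l) :
    H.nbhdOrder Q = m ∧
      ∀ R, φ.onPoint Q ≠ φ.onPoint R → H.nbhdOrder R = H.nbhdOrder P := by
  obtain ⟨k, hk⟩ := h.twoUniform.nbhd_card Q
  have hkP : H.nbhdOrder P = k := by
    rw [h.nbhdOrder_eq_mul_traceCount hPQ.symm hQl hPl hk,
      h.traceCount_eq_one_of_two_le hPQ hPl hQl hc, mul_one]
  have hn := (h.nbhdOrder_spec P).1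
  have key : ∀ l R, φ.onPoint Q ≠ φ.onPoint R → A.Inc (φ.onPoint Q) l → A.Inc (φ.onPoint R) l →
      φ.traceCount Q l = 1 := by
    intro l R hQR hQ hR
    have h1 := h.nbhdOrder_eq_mul_traceCount hQR hQ hR hk
    have h2 := hP R
    rw [h1, hkP] at h2
    exact le_antisymm (Nat.le_of_mul_le_mul_left (by omega) (by omega : 0 < k))
      (h.one_le_traceCount hQ)
  refine ⟨h.nbhdOrder_eq_of_traceCount_eq_one hm fun l hl => ?_, fun R hR => ?_⟩
  · obtain ⟨R, hQR, hRl⟩ := h.exists_point_over_ne Q l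
    exact key l R hQR hl hRl
  · obtain ⟨l, ⟨hQ, hR'⟩, -⟩ := h.isAffinePlane.existsUnique_line _ _ hR
    rw [h.nbhdOrder_eq_mul_traceCount hR hQ hR' hk, key l R hR hQ hR', mul_one, hkP]

theorem nbhdOrder_le [Finite Point] [Finite Line] (h : φ.IsNeighbourMap) {m : ℕ}
    (hm : ∀ p, Nat.card {l // A.Inc p l} = m + 1) (X : Point) : H.nbhdOrder X ≤ m := by
  have : Nonempty Point := ⟨X⟩
  obtain ⟨P, hP⟩ := Finite.exists_max H.nbhdOrder
  refine (hP X).trans ?_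
  by_contra! hPm
  have : ∃ l, A.Inc (φ.onPoint P) l ∧ 2 ≤ φ.traceCount P l := by
    by_contra! hc
    refine hPm.ne' (h.nbhdOrder_eq_of_traceCount_eq_one hm fun l hl => ?_)
    have h1 := hc l hl
    have h2 := h.one_le_traceCount hl
    omega
  obtain ⟨l, hPl, hc⟩ := this
  obtain ⟨Q, hPQ, hQl⟩ := h.exists_point_over_ne P l
  obtain ⟨hQ, hQR⟩ := h.nbhdOrder_of_maximal hm hP hPl hc hPQ hQl
  -- The order is `m` at `Q` but maximal at `R` on a second line `l'`. The formula at `P` then makes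
  -- the count along `l'` exceed that along `l`, hence at least 2, so the same argument along `l'`
  -- gives order `m` at `R`.
  obtain ⟨l', hPl', hne⟩ := h.isAffinePlane.exists_line_ne (φ.onPoint P) l
  obtain ⟨R, hPR, hRl'⟩ := h.exists_point_over_ne P l'
  have hne' : φ.onPoint Q ≠ φ.onPoint R := fun he =>
    hPQ (h.isAffinePlane.point_unique hne hPl' hPl (he ▸ hRl') hQl)
  obtain ⟨k, hk⟩ := h.twoUniform.nbhd_card P
  have e1 := h.nbhdOrder_eq_mul_traceCount hPQ hPl hQl hk
  have e2 := h.nbhdOrder_eq_mul_traceCount hPR hPl' hRl' hk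
  rw [hQR R hne'] at e2
  rw [hQ] at e1
  have hlt : φ.traceCount P l < φ.traceCount P l' :=
    Nat.lt_of_mul_lt_mul_left (a := k) (by omega)
  have hR := (h.nbhdOrder_of_maximal hm hP hPl' (by omega) hPR hRl').1
  have := hQR R hne'
  omega

/-- Lines over the same line which meet have the same trace in the neighbourhood of a common
point. -/
theorem inc_iff_inc [Finite Point] [Finite Line] (h : φ.IsNeighbourMap) {X Z : Point} {g g' : Line}
    (hgg' : φ.onLine g = φ.onLine g') (hXg : H.Inc X g) (hXg' : H.Inc X g')
    (hZ : φ.onPoint Z = φ.onPoint X) : H.Inc Z g ↔ H.Inc Z g' := by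
  have : Finite Point' := Finite.of_surjective _ φ.onPoint_surjective
  have : Finite Line' := Finite.of_surjective _ φ.onLine_surjective
  obtain ⟨m, -, hm, -⟩ := h.isAffinePlane.exists_order
  have hc := h.traceCount_eq_one_of_nbhdOrder_le hm (h.nbhdOrder_le hm X) (φ.map_inc _ _ hXg)
  -- Only one trace over this line passes through `X`, so those of `g` and `g'` agree.
  have := Finite.card_le_one_iff_subsingleton.1 hc.le
  have he := this.elim ⟨H.traceLine X g ⟨X, neighbour_refl X, hXg⟩, g, rfl, hXg, rfl⟩
    ⟨H.traceLine X g' ⟨X, neighbour_refl X, hXg'⟩, g', hgg'.symm, hXg', rfl⟩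
  have he' : H.trace X g = H.trace X g' := congrArg (fun S => S.1.1) he
  exact Set.ext_iff.1 he' ⟨Z, (h.onPoint_eq_iff _ _).1 hZ⟩

theorem nbhdOrder_eq [Finite Point] [Finite Line] (h : φ.IsNeighbourMap) {m : ℕ}
    (hm : ∀ p, Nat.card {l // A.Inc p l} = m + 1) (X : Point) : H.nbhdOrder X = m :=
  h.nbhdOrder_eq_of_traceCount_eq_one hm fun _ hl =>
    h.traceCount_eq_one_of_nbhdOrder_le hm (h.nbhdOrder_le hm X) hl

end Epimorphism.IsNeighbourMap

/-! ### Parallel classes of traces and orthogonal arrays -/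

namespace Epimorphism

variable {H : IncidenceStructure Point Line} {A : IncidenceStructure Point' Line'}

/-- A point of `H` over a given point. -/
noncomputable def pointOver (φ : Epimorphism H A) (p : Point') : Point :=
  Function.surjInv φ.onPoint_surjective p

theorem onPoint_pointOver (φ : Epimorphism H A) (p : Point') : φ.onPoint (φ.pointOver p) = p :=
  Function.surjInv_eq φ.onPoint_surjective p

/-- The traces, in the neighbourhood over `p`, of the lines over `l`. -/
def traceClass (φ : Epimorphism H A) (p : Point') (l : Line') : Set (H.NbhdLine (φ.pointOver p)) :=
  {S | ∃ g, φ.onLine g = l ∧ S.1 = H.trace (φ.pointOver p) g}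

namespace IsNeighbourMap

variable {φ : Epimorphism H A}

theorem exists_neighbour_pointOver (h : φ.IsNeighbourMap) {p : Point'} {l : Line'}
    (hp : A.Inc p l) {g : Line} (hg : φ.onLine g = l) :
    ∃ Z, H.PointNeighbour Z (φ.pointOver p) ∧ H.Inc Z g :=
  h.exists_neighbour_inc (by rwa [onPoint_pointOver, hg])

theorem traceLine_mem (h : φ.IsNeighbourMap) {p : Point'} {l : Line'} (hp : A.Inc p l) {g : Line}
    (hg : φ.onLine g = l) :
    H.traceLine (φ.pointOver p) g (h.exists_neighbour_pointOver hp hg) ∈ φ.traceClass p l :=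
  ⟨g, hg, rfl⟩

/-- Traces over `l` that meet coincide by `inc_iff_inc`; conversely, a trace disjoint from that of
`g` comes from a line over `l` by `onLine_eq_of_parallel`. -/
theorem traceClass_eq [Finite Point] [Finite Line] (h : φ.IsNeighbourMap) {p : Point'} {l : Line'}
    (hp : A.Inc p l) {g : Line} (hg : φ.onLine g = l) :
    φ.traceClass p l = {S | (H.nbhdRestriction (φ.pointOver p)).Parallel S
      (H.traceLine (φ.pointOver p) g (h.exists_neighbour_pointOver hp hg))} := by
  have key : ∀ Z W, H.PointNeighbour Z (φ.pointOver p) → H.PointNeighbour W (φ.pointOver p) →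
      φ.onPoint Z = φ.onPoint W := fun Z W hZ hW =>
    ((h.onPoint_eq_iff _ _).2 hZ).trans ((h.onPoint_eq_iff _ _).2 hW).symm
  ext ⟨S, hS⟩
  constructor
  · rintro ⟨g', hg', rfl : S = _⟩
    by_cases hd : ∃ Z : H.NbhdPoint (φ.pointOver p), H.Inc Z.1 g' ∧ H.Inc Z.1 g
    · obtain ⟨Z, hZ', hZ⟩ := hd
      exact Or.inl (Subtype.ext (Set.ext fun W =>
        h.inc_iff_inc (hg'.trans hg.symm) hZ' hZ (key _ _ W.2 Z.2)))
    · exact Or.inr (not_exists.1 hd)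
  · rintro (he | hd)
    · exact ⟨g, hg, congrArg Subtype.val he⟩
    · obtain ⟨⟨Z, hZ⟩, g', rfl⟩ := hS
      have hg' := φ.map_inc _ _ (show H.Inc Z.1 g' from hZ)
      rw [(h.onPoint_eq_iff _ _).2 Z.2] at hg'
      refine ⟨g', (h.onLine_eq_of_parallel (g' := g) hg' ?_ fun W hW hW' => hd ⟨W, hW⟩ hW').trans hg,
        rfl⟩
      rwa [onPoint_pointOver, hg]

theorem isParallelClass_traceClass [Finite Point] [Finite Line] (h : φ.IsNeighbourMap) {p : Point'}
    {l : Line'} (hp : A.Inc p l) :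
    (H.nbhdRestriction (φ.pointOver p)).IsParallelClass (φ.traceClass p l) := by
  obtain ⟨g, hg⟩ := φ.onLine_surjective l
  exact ⟨_, h.traceClass_eq hp hg⟩

theorem traceClass_injective [Finite Point] (h : φ.IsNeighbourMap) {p : Point'}
    {l l' : Line'} (hp : A.Inc p l) (he : φ.traceClass p l = φ.traceClass p l') : l = l' := by
  obtain ⟨g, hg⟩ := φ.onLine_surjective l
  have hm := h.traceLine_mem hp hg
  rw [he] at hm
  obtain ⟨g', hg', hS⟩ := hm
  exact hg.symm.trans ((h.onLine_eq_of_trace _ rfl hS).trans hg')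

theorem card_traceClass [Finite Point] [Finite Line] (h : φ.IsNeighbourMap) {m : ℕ}
    (hm : ∀ p, Nat.card {l // A.Inc p l} = m + 1) {p : Point'} {l : Line'} (hp : A.Inc p l) :
    Nat.card (φ.traceClass p l) = m := by
  obtain ⟨g, hg⟩ := φ.onLine_surjective l
  have hF := h.twoUniform.nbhd_isAffinePlane (φ.pointOver p)
  set S := H.traceLine (φ.pointOver p) g (h.exists_neighbour_pointOver hp hg)
  obtain ⟨Z, hZ, -⟩ := h.exists_ne_of_nbhdLine S
  obtain ⟨d, hZd, hd⟩ := hF.exists_line_ne Z S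
  rw [h.traceClass_eq hp hg]
  exact (hF.card_parallel hZd hZ hd).trans (((h.nbhdOrder_spec _).2.2.1 d).trans
    (h.nbhdOrder_eq hm _))

/-- The required line joins any point of `S` to any point of `T`; by `inc_iff_inc` its traces are
all of `S` and all of `T`. This is the orthogonal array property. -/
theorem existsUnique_line_of_traces [Finite Point] [Finite Line] (h : φ.IsNeighbourMap)
    {p q : Point'} (hpq : p ≠ q) {l : Line'} (hp : A.Inc p l) (hq : A.Inc q l)
    {S : H.NbhdLine (φ.pointOver p)} (hS : S ∈ φ.traceClass p l)
    {T : H.NbhdLine (φ.pointOver q)} (hT : T ∈ φ.traceClass q l) :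
    ∃! g : {g // φ.onLine g = l},
      H.trace (φ.pointOver p) g = S.1 ∧ H.trace (φ.pointOver q) g = T.1 := by
  obtain ⟨⟨S, ⟨X, hX⟩, -⟩, ⟨a, ha, rfl : S = _⟩⟩ := S, hS
  obtain ⟨⟨T, ⟨Y, hY⟩, -⟩, ⟨b, hb, rfl : T = _⟩⟩ := T, hT
  have hXp := ((h.onPoint_eq_iff _ _).2 X.2).trans (φ.onPoint_pointOver p)
  have hYq := ((h.onPoint_eq_iff _ _).2 Y.2).trans (φ.onPoint_pointOver q)
  have hXY : φ.onPoint X.1 ≠ φ.onPoint Y.1 := by rwa [hXp, hYq]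
  obtain ⟨g, hg, hXg, hYg⟩ := h.exists_join hXY (l := l) (by rwa [hXp]) (by rwa [hYq])
  refine ⟨⟨g, hg⟩, ⟨?_, ?_⟩, ?_⟩
  · exact Set.ext fun Z => h.inc_iff_inc (hg.trans ha.symm) hXg hX
      (((h.onPoint_eq_iff _ _).2 Z.2).trans ((h.onPoint_eq_iff _ _).2 X.2).symm)
  · exact Set.ext fun Z => h.inc_iff_inc (hg.trans hb.symm) hYg hY
      (((h.onPoint_eq_iff _ _).2 Z.2).trans ((h.onPoint_eq_iff _ _).2 Y.2).symm)
  · rintro ⟨g', hg'⟩ ⟨hX', hY'⟩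
    exact Subtype.ext (h.line_unique hXY (hX'.ge hX) (hY'.ge hY) hXg hYg)

theorem card_lines_over [Finite Point] [Finite Line] (h : φ.IsNeighbourMap) {m : ℕ}
    (hm : ∀ p, Nat.card {l // A.Inc p l} = m + 1) (l : Line') :
    Nat.card {g // φ.onLine g = l} = m ^ 2 := by
  obtain ⟨P, -, -⟩ := h.isAffinePlane.exists_triangle
  obtain ⟨X, -, hX⟩ := h.exists_point_over_ne (φ.pointOver P) l
  obtain ⟨Y, hXY, hY⟩ := h.exists_point_over_ne X l
  have e : Nat.card {g // φ.onLine g = l} =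
      Nat.card (φ.traceClass (φ.onPoint X) l × φ.traceClass (φ.onPoint Y) l) := by
    refine Nat.card_eq_of_bijective (fun g => ⟨⟨_, h.traceLine_mem hX g.2⟩,
      ⟨_, h.traceLine_mem hY g.2⟩⟩) ⟨?_, ?_⟩
    · intro g g' hh
      simp only [Prod.mk.injEq, Subtype.mk.injEq, traceLine] at hh
      exact (h.existsUnique_line_of_traces hXY hX hY (h.traceLine_mem hX g'.2)
        (h.traceLine_mem hY g'.2)).unique hh ⟨rfl, rfl⟩
    · rintro ⟨⟨S, hS⟩, ⟨T, hT⟩⟩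
      obtain ⟨g, hgS, hgT⟩ := (h.existsUnique_line_of_traces hXY hX hY hS hT).exists
      exact ⟨g, Prod.ext (Subtype.ext (Subtype.ext hgS)) (Subtype.ext (Subtype.ext hgT))⟩
  rw [e, Nat.card_prod, h.card_traceClass hm hX, h.card_traceClass hm hY, sq]

theorem nonempty_equiv_of_card {α : Type*} {m : ℕ} [Finite α] (h : Nat.card α = m) :
    Nonempty (α ≃ Fin m) :=
  h ▸ ⟨Finite.equivFin α⟩

/-- The orthogonal array of the line `l` of `A`: the entry of a line `g` over `l` in the column of
`p` is the label of the trace of `g` over `p`. -/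
noncomputable def array [Finite Point] [Finite Line] (h : φ.IsNeighbourMap) {m : ℕ} (l : Line')
    (row : {g // φ.onLine g = l} ≃ Fin (m ^ 2)) (column : {p // A.Inc p l} ≃ Fin m)
    (label : ∀ p : {p // A.Inc p l}, Fin m ≃ φ.traceClass p.1 l) : OrthogonalArray 2 m m where
  entry i c := (label (column.symm c)).symm
    ⟨_, h.traceLine_mem (column.symm c).2 (row.symm i).2⟩
  existsUnique_row c s := by
    have hne : (column.symm (c 0)).1 ≠ (column.symm (c 1)).1 := fun hh => by
      simpa using c.injective (column.symm.injective (Subtype.ext hh))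
    obtain ⟨g, ⟨hg0, hg1⟩, hu⟩ := h.existsUnique_line_of_traces hne (column.symm (c 0)).2
      (column.symm (c 1)).2 (label (column.symm (c 0)) (s 0)).2
      (label (column.symm (c 1)) (s 1)).2
    refine ⟨row g, fun j => ?_, fun i hi => ?_⟩
    · rw [Equiv.symm_apply_eq]
      refine Subtype.ext (Subtype.ext ?_)
      fin_cases j
      · simpa [traceLine] using hg0
      · simpa [traceLine] using hg1
    · rw [← Equiv.symm_apply_eq]
      have h0 := congrArg (fun z => z.1.1) ((Equiv.symm_apply_eq _).1 (hi 0))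
      have h1 := congrArg (fun z => z.1.1) ((Equiv.symm_apply_eq _).1 (hi 1))
      exact hu (row.symm i) ⟨h0, h1⟩

theorem array_entry [Finite Point] [Finite Line] (h : φ.IsNeighbourMap) {m : ℕ} {l : Line'}
    (row : {g // φ.onLine g = l} ≃ Fin (m ^ 2)) (column : {p // A.Inc p l} ≃ Fin m)
    (label : ∀ p : {p // A.Inc p l}, Fin m ≃ φ.traceClass p.1 l) (g : {g // φ.onLine g = l})
    (p : {p // A.Inc p l}) :
    label p ((h.array l row column label).entry (row g) (column p)) =
      ⟨_, h.traceLine_mem p.2 g.2⟩ := by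
  -- The type of `label p'` depends on `p'`, so the inverse equivalences are cancelled by
  -- substitution rather than rewriting.
  have key : ∀ g' p', g' = g → p' = p →
      (label p').symm ⟨_, h.traceLine_mem p'.2 g'.2⟩ =
        (label p).symm ⟨_, h.traceLine_mem p.2 g.2⟩ := by
    rintro _ _ rfl rfl
    rfl
  rw [← Equiv.eq_symm_apply]
  exact key _ _ (row.symm_apply_apply g) (column.symm_apply_apply p)

/-! ### The isomorphism -/

theorem exists_iso_result {Point' : Type u} {Line' : Type v} {A : IncidenceStructure Point' Line'}
    {φ : Epimorphism H A} [Finite Point] [Finite Line] (h : φ.IsNeighbourMap) :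
    ∃ (m : ℕ) (D : AffineConstruction.{u, v, u, u} m), Nonempty (Iso H D.result) := by
  have : Finite Point' := Finite.of_surjective _ φ.onPoint_surjective
  have : Finite Line' := Finite.of_surjective _ φ.onLine_surjective
  obtain ⟨m, -, hm, hl, -⟩ := h.isAffinePlane.exists_order
  have row := fun l => (nonempty_equiv_of_card (h.card_lines_over hm l)).some
  have column := fun l => (nonempty_equiv_of_card (hl l)).some
  have label := fun (p : Point') (l : {l // A.Inc p l}) =>
    (nonempty_equiv_of_card (h.card_traceClass hm l.2)).some.symm
  let D : AffineConstruction.{u, v, u, u} m :=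
    { BasePoint := Point'
      BaseLine := Line'
      base := A
      base_order := ⟨h.isAffinePlane, inferInstance, hl⟩
      FibrePoint := fun p => H.NbhdPoint (φ.pointOver p)
      FibreLine := fun p => H.NbhdLine (φ.pointOver p)
      fibre := fun p => H.nbhdRestriction (φ.pointOver p)
      fibre_order := fun p => ⟨h.twoUniform.nbhd_isAffinePlane _, inferInstance, fun S =>
        ((h.nbhdOrder_spec _).2.2.1 S).trans (h.nbhdOrder_eq hm _)⟩
      array := fun l => h.array l (row l) (column l) fun p => label p.1 ⟨l, p.2⟩
      column := column
      parallelClass := fun p l => φ.traceClass p l.1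
      isParallelClass := fun p l => h.isParallelClass_traceClass l.2
      parallelClass_injective := fun p l l' he => Subtype.ext (h.traceClass_injective l.2 he)
      label := label }
  have hover : ∀ X, H.PointNeighbour X (φ.pointOver (φ.onPoint X)) := fun X =>
    (h.onPoint_eq_iff _ _).1 (φ.onPoint_pointOver _).symm
  refine ⟨m, D, ⟨
    { pointEquiv := Equiv.ofBijective (fun X => ⟨φ.onPoint X, ⟨X, hover X⟩⟩) ⟨?_, ?_⟩
      lineEquiv := Equiv.ofBijective (fun g => (φ.onLine g, row _ ⟨g, rfl⟩)) ⟨?_, ?_⟩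
      inc_iff := ?_ }⟩⟩
  · intro X Y hh
    exact congrArg (fun z : Σ p, H.NbhdPoint (φ.pointOver p) => z.2.1) hh
  · rintro ⟨p, Z, hZ⟩
    obtain rfl : φ.onPoint Z = p := ((h.onPoint_eq_iff _ _).2 hZ).trans (φ.onPoint_pointOver p)
    exact ⟨Z, rfl⟩
  · intro g g' hh
    -- The type of the row bijection depends on the image line, so `g` is recovered from an
    -- arbitrary pair `z`.
    have key : ∀ z : Line' × Fin (m ^ 2), ∀ g : Line, (φ.onLine g, row _ ⟨g, rfl⟩) = z →
        g = ((row z.1).symm z.2).1 := by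
      rintro _ g rfl
      simp
    exact (key _ g rfl).trans (key _ g' hh.symm).symm
  · rintro ⟨l, i⟩
    obtain ⟨⟨g, rfl⟩, rfl⟩ := (row l).surjective i
    exact ⟨g, rfl⟩
  · intro X g
    have key : ∀ hX : A.Inc (φ.onPoint X) (φ.onLine g),
        (label (φ.onPoint X) ⟨φ.onLine g, hX⟩ ((D.array (φ.onLine g)).entry (row _ ⟨g, rfl⟩)
          (column _ ⟨φ.onPoint X, hX⟩))).1.1 = H.trace (φ.pointOver (φ.onPoint X)) g := fun hX =>
      congrArg (fun z => z.1.1) (h.array_entry (row _) (column _)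
        (fun p => label p.1 ⟨φ.onLine g, p.2⟩) ⟨g, rfl⟩ ⟨φ.onPoint X, hX⟩)
    constructor
    · rintro ⟨hX, hinc⟩
      exact (key hX).le (show (⟨X, hover X⟩ : H.NbhdPoint _) ∈ _ from hinc)
    · intro hXg
      exact ⟨φ.map_inc _ _ hXg, (key (φ.map_inc _ _ hXg)).ge
        (show (⟨X, hover X⟩ : H.NbhdPoint _) ∈ H.trace _ g from hXg)⟩

end IsNeighbourMap

end Epimorphism

end IncidenceStructure

theorem mainTheorem3 {Point : Type u} {Line : Type v} [Finite Point] [Finite Line]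
    (H : IncidenceStructure Point Line) (hH : H.IsTwoUniformAffineHjelmslevPlane) :
    ∃ (m : ℕ) (D : AffineConstruction.{u, v, u, u} m),
      Nonempty (IncidenceStructure.Iso H D.result) := by
  obtain ⟨Point', Line', A, φ, hA, hp, hl, hpar⟩ := hH.isAffineHjelmslevPlane.exists_epimorphism
  exact IncidenceStructure.Epimorphism.IsNeighbourMap.exists_iso_result (φ := φ) ⟨hH, hA, hp, hl, hpar⟩
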